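/- Let $\mathbb D$ be the open unit disc, $\mathbb T$ the unit circle with normalized Lebesgue measure $\sigma$, and $N^+$ the Smirnov class, i.e. the holomorphic $f$ on $\mathbb D$ for which the functions $\zeta\mapsto\log^+|f(r\zeta)|$, $0\le r<1$, are uniformly integrable on $\mathbb T$; each $f\in N^+$ has a nontangential boundary value $f(\zeta)$ at almost every $\zeta\in\mathbb T$. For $\psi:\mathbb R\to[0,\infty)$, with the convention $\psi(-\infty)=0$, let $$\mathcal H_{\psi\circ\log}=\Big\{f\in N^+:\int_{\mathbb T}\psi(\log|f(\zeta)|)\,d\sigma(\zeta)<\infty\Big\}.$$ A function $\varphi:\mathbb R\to[0,\infty)$ is strongly convex if it is convex, nondecreasing and $\varphi(t)/t\to\infty$ as $t\to\infty$. A strictly increasing concave function $\gamma:(0,\infty)\to[0,\infty)$ with $\gamma(t)\to\infty$ as $t\to\infty$ is $\tilde\Delta$-admissible for $\varphi$ if there are $c>1$ and $t_0\in\mathbb R$ such that $\varphi(t+\gamma(t))\le c\,\varphi(t)$ for all $t>0$ with $t\ge t_0$; $\varphi$ satisfies the $\tilde\Delta$-condition if such a $\gamma$ exists. For a set $X$ of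 holomorphic functions on $\mathbb D$ let $\operatorname{Alg}(X)$ be the (unital, complex) algebra it generates and $\operatorname{Mult}(X)=\{g \text{ holomorphic on } \mathbb D: gf\in X \text{ for all } f\in X\}$. **Theorem.** Let $\varphi$ be strongly convex and satisfy the $\tilde\Delta$-condition, let $\gamma$ be $\tilde\Delta$-admissible for $\varphi$, and put $\Phi=\varphi\circ\log$ and $\Psi_\gamma=\varphi\circ\gamma^{-1}\circ\log$, where $\gamma^{-1}(s)=\inf\{t>0:\gamma(t)\ge s\}$ for $s\in\mathbb R$ (the inverse function of $\gamma$ on its range, and $0$ to the left of the range). Then $$\operatorname{Alg}(\mathcal H_{\Psi_\gamma})\subset\operatorname{Mult}(\mathcal H_\Phi).$$ -/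

import Mathlib

open Set Filter Topology MeasureTheory

noncomputable section

namespace HardyOrlicz

/-- `Hol(𝔻)`: the algebra of holomorphic functions on the open unit disc, as a subalgebra of all
functions `𝔻 → ℂ`. -/
def Hol : Subalgebra ℂ (Complex.UnitDisc → ℂ) where
  carrier := {f | ∃ F : ℂ → ℂ, DifferentiableOn ℂ F (Metric.ball 0 1) ∧
    ∀ z : Complex.UnitDisc, f z = F z}
  mul_mem' := by
    rintro f g ⟨F, hF, hfF⟩ ⟨G, hG, hgG⟩
    exact ⟨F * G, hF.mul hG, fun z => by simp [hfF z, hgG z]⟩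
  add_mem' := by
    rintro f g ⟨F, hF, hfF⟩ ⟨G, hG, hgG⟩
    exact ⟨F + G, hF.add hG, fun z => by simp [hfF z, hgG z]⟩
  algebraMap_mem' := fun c => ⟨fun _ => c, differentiableOn_const c, fun _ => rfl⟩

/-- A holomorphic function on the disc is applied to points of the disc. -/
instance : CoeFun Hol (fun _ => Complex.UnitDisc → ℂ) := ⟨fun f => f.1⟩

/-- Normalized Lebesgue measure on the unit circle, the circle being parametrized by
`θ ↦ exp (i θ)`, `-π < θ ≤ π`. -/
def arc : Measure ℝ :=
  ENNReal.ofReal (1 / (2 * Real.pi)) • volume.restrict (Ioc (-Real.pi) Real.pi)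

/-- The point `r * exp (i θ)` of the disc, `0 ≤ r < 1`. -/
def polar (r : Ico (0 : ℝ) 1) (θ : ℝ) : Complex.UnitDisc :=
  Complex.UnitDisc.mk ((r : ℝ) * (Circle.exp θ : ℂ)) (by
    rw [norm_mul, Circle.norm_coe, mul_one, Complex.norm_real, Real.norm_eq_abs,
      abs_of_nonneg r.2.1]
    exact r.2.2)

/-- Nontangential approach to `ζ` inside the Stolz region `|z - ζ| < a (1 - |z|)`. -/
def stolz (a : ℝ) (ζ : ℂ) : Filter Complex.UnitDisc :=
  comap (fun z : Complex.UnitDisc => (z : ℂ)) (𝓝 ζ) ⊓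
    𝓟 {z : Complex.UnitDisc | ‖(z : ℂ) - ζ‖ < a * (1 - ‖(z : ℂ)‖)}

/-- `b θ` is, for almost every `θ`, the nontangential boundary value of `f` at `exp (i θ)`. -/
def IsBoundaryValue (f : Hol) (b : ℝ → ℂ) : Prop :=
  ∀ᵐ θ ∂arc, ∀ a : ℝ, 1 < a → Tendsto f (stolz a (Circle.exp θ : ℂ)) (𝓝 (b θ))

/-- The Smirnov class `N⁺`: the functions `f` holomorphic on the disc such that the functions
`ζ ↦ log⁺ |f (r ζ)|`, `0 ≤ r < 1`, are uniformly integrable on the circle. -/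
def Smirnov : Set Hol :=
  {f | UniformIntegrable (fun (r : Ico (0 : ℝ) 1) (θ : ℝ) => Real.posLog ‖f (polar r θ)‖) 1 arc}

/-- `φ ∘ log` on `[0, ∞)`, with the convention `φ (-∞) = 0`. -/
def compLog (φ : ℝ → ℝ) (s : ℝ) : ℝ := if s = 0 then 0 else φ (Real.log s)

/-- The Hardy-Orlicz class with defining function `φ ∘ log`: the `f ∈ N⁺` whose nontangential
boundary function `b` satisfies `∫ φ (log |b|) < ∞`. For `f ∈ N⁺` the function `b` exists, and it
is unique and measurable up to null sets. -/
def HardyOrliczClass (φ : ℝ → ℝ) : Set Hol :=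
  {f | f ∈ Smirnov ∧ ∃ b : ℝ → ℂ, IsBoundaryValue f b ∧
    ∫⁻ θ, ENNReal.ofReal (compLog φ ‖b θ‖) ∂arc < ⊤}

/-- The multipliers of a set of holomorphic functions. -/
def Mult (X : Set Hol) : Set Hol := {g | ∀ f ∈ X, g * f ∈ X}

/-- Strongly convex functions `φ : ℝ → [0, ∞)`. -/
structure StronglyConvex (φ : ℝ → ℝ) : Prop where
  nonneg : ∀ t, 0 ≤ φ t
  convex : ConvexOn ℝ univ φ
  mono : Monotone φ
  superlinear : Tendsto (fun t => φ t / t) atTop atTop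

/-- `γ : (0, ∞) → [0, ∞)` is `Δ̃`-admissible for `φ`; the values of `γ` off `(0, ∞)` are
irrelevant. -/
structure DeltaAdmissible (φ γ : ℝ → ℝ) : Prop where
  nonneg : ∀ t, 0 < t → 0 ≤ γ t
  strictMono : StrictMonoOn γ (Ioi 0)
  concave : ConcaveOn ℝ (Ioi 0) γ
  tendsto : Tendsto γ atTop atTop
  bound : ∃ c : ℝ, 1 < c ∧ ∃ t₀ : ℝ, ∀ t, 0 < t → t₀ ≤ t → φ (t + γ t) ≤ c * φ t

/-- The `Δ̃`-condition on `φ`. -/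
def DeltaCondition (φ : ℝ → ℝ) : Prop := ∃ γ : ℝ → ℝ, DeltaAdmissible φ γ

/-- The inverse of `γ : (0, ∞) → [0, ∞)`. For continuous increasing `γ` this is the inverse
function on the range of `γ`, and `0` to the left of the range. -/
def genInverse (γ : ℝ → ℝ) (s : ℝ) : ℝ := sInf {t : ℝ | 0 < t ∧ s ≤ γ t}

end HardyOrlicz

end

/-! Everything rests on the pointwise bound `φ (s + u) ≤ c * (φ s + φ (genInverse γ u) + K)` of
`exists_add_le`. For large `s`, either `u ≤ γ s` and admissibility applies at `s`, or `u > γ s`, so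
that `genInverse γ u` dominates `s` and admissibility applies there. With `s = log |f|` and `u = log
|g|` on the circle, integration shows that the generators of the algebra are multipliers
(`hardyOrliczClass_subset_mult`). With `u = log 2` the same bound makes the target class closed
under addition (`hardyOrliczClass_add`), so its multipliers are closed under sums; they are closed
under products by composition. Membership in `N⁺` follows from the subadditivity properties of
`log⁺`. -/

namespace HardyOrlicz

/-! ### Uniformly integrable families -/

section UniformIntegrability

/-- A dominated family of measurable functions inherits uniform integrability. -/
theorem uniformIntegrable_of_norm_le {α ι E F : Type*} [MeasurableSpace α] {μ : Measure α}
    [NormedAddCommGroup E] [NormedAddCommGroup F] {p : ENNReal} {f : ι → α → E} {g : ι → α → F}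
    (hg : UniformIntegrable g p μ) (hf : ∀ i, AEStronglyMeasurable (f i) μ)
    (hfg : ∀ i x, ‖f i x‖ ≤ ‖g i x‖) : UniformIntegrable f p μ := by
  obtain ⟨-, hu, C, hC⟩ := hg
  refine ⟨hf, fun ε hε => ?_, C, fun i => (eLpNorm_mono (hfg i)).trans (hC i)⟩
  obtain ⟨δ, hδ, h⟩ := hu hε
  refine ⟨δ, hδ, fun i s hs hμ => (eLpNorm_mono fun x => ?_).trans (h i s hs hμ)⟩
  by_cases hx : x ∈ s
  · simpa [hx] using hfg i x
  · simp [hx]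

theorem uniformIntegrable_add {α ι E : Type*} [MeasurableSpace α] {μ : Measure α}
    [NormedAddCommGroup E] {p : ENNReal} {f g : ι → α → E}
    (hf : UniformIntegrable f p μ) (hg : UniformIntegrable g p μ) (hp : 1 ≤ p) :
    UniformIntegrable (f + g) p μ := by
  obtain ⟨hfm, hfu, C, hC⟩ := hf
  obtain ⟨hgm, hgu, D, hD⟩ := hg
  refine ⟨fun i => (hfm i).add (hgm i), hfu.add hgu hp hfm hgm, C + D, fun i => ?_⟩
  rw [ENNReal.coe_add]
  exact (eLpNorm_add_le (hfm i) (hgm i) hp).trans (add_le_add (hC i) (hD i))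

end UniformIntegrability

instance : IsFiniteMeasure arc := by
  unfold arc
  exact Measure.smul_finite _ ENNReal.ofReal_ne_top

/-! ### Algebraic closure of the Smirnov class -/

section Smirnov

theorem continuous_polar (r : Ico (0 : ℝ) 1) : Continuous (polar r) := by
  refine Complex.UnitDisc.isEmbedding_coe.continuous_iff.2 ?_
  change Continuous fun θ : ℝ => ((r : ℝ) : ℂ) * (Circle.exp θ : ℂ)
  fun_prop

theorem continuous_hol (f : Hol) : Continuous (f : Complex.UnitDisc → ℂ) := by
  obtain ⟨F, hF, hfF⟩ := f.2
  have : (f.1 : Complex.UnitDisc → ℂ) = fun z : Complex.UnitDisc => F (z : ℂ) := funext hfF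
  rw [this]
  exact hF.continuousOn.comp_continuous Complex.UnitDisc.continuous_coe
    fun z => by simpa using z.norm_lt_one

theorem continuous_posLog_polar (f : Hol) (r : Ico (0 : ℝ) 1) :
    Continuous fun θ : ℝ => Real.posLog ‖f (polar r θ)‖ :=
  Real.continuous_posLog.comp ((continuous_hol f).comp (continuous_polar r)).norm

theorem Smirnov.mul {f g : Hol} (hf : f ∈ Smirnov) (hg : g ∈ Smirnov) : f * g ∈ Smirnov := by
  refine uniformIntegrable_of_norm_le (uniformIntegrable_add hf hg le_rfl)
    (fun r => (continuous_posLog_polar _ r).aestronglyMeasurable) fun r θ => ?_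
  change ‖Real.posLog ‖f (polar r θ) * g (polar r θ)‖‖ ≤
    ‖Real.posLog ‖f (polar r θ)‖ + Real.posLog ‖g (polar r θ)‖‖
  rw [Real.norm_of_nonneg Real.posLog_nonneg,
    Real.norm_of_nonneg (add_nonneg Real.posLog_nonneg Real.posLog_nonneg), norm_mul]
  exact Real.posLog_mul

theorem Smirnov.algebraMap_mem (c : ℂ) : algebraMap ℂ Hol c ∈ Smirnov :=
  uniformIntegrable_const le_rfl ENNReal.one_ne_top
    (memLp_const (Real.posLog ‖c‖) : MemLp (fun _ : ℝ => Real.posLog ‖c‖) 1 arc)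

theorem Smirnov.add {f g : Hol} (hf : f ∈ Smirnov) (hg : g ∈ Smirnov) : f + g ∈ Smirnov := by
  have h2 : UniformIntegrable (fun (_ : Ico (0 : ℝ) 1) (_ : ℝ) => Real.log 2) 1 arc :=
    uniformIntegrable_const le_rfl ENNReal.one_ne_top (memLp_const _)
  refine uniformIntegrable_of_norm_le
    (uniformIntegrable_add h2 (uniformIntegrable_add hf hg le_rfl) le_rfl)
    (fun r => (continuous_posLog_polar _ r).aestronglyMeasurable) fun r θ => ?_
  change ‖Real.posLog ‖f (polar r θ) + g (polar r θ)‖‖ ≤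
    ‖Real.log 2 + (Real.posLog ‖f (polar r θ)‖ + Real.posLog ‖g (polar r θ)‖)‖
  rw [Real.norm_of_nonneg Real.posLog_nonneg, ← add_assoc]
  refine le_trans ?_ (Real.le_norm_self _)
  linarith [Real.posLog_norm_add_le (f (polar r θ)) (g (polar r θ))]

end Smirnov

/-! ### Nontangential boundary values -/

section BoundaryValue

theorem IsBoundaryValue.mul {f g : Hol} {a b : ℝ → ℂ} (hf : IsBoundaryValue f a)
    (hg : IsBoundaryValue g b) : IsBoundaryValue (f * g) fun θ => a θ * b θ := by
  filter_upwards [hf, hg] with θ h h' s hs using (h s hs).mul (h' s hs)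

theorem IsBoundaryValue.add {f g : Hol} {a b : ℝ → ℂ} (hf : IsBoundaryValue f a)
    (hg : IsBoundaryValue g b) : IsBoundaryValue (f + g) fun θ => a θ + b θ := by
  filter_upwards [hf, hg] with θ h h' s hs using (h s hs).add (h' s hs)

theorem isBoundaryValue_algebraMap (c : ℂ) : IsBoundaryValue (algebraMap ℂ Hol c) fun _ => c :=
  Eventually.of_forall fun _ _ _ => tendsto_const_nhds

/-- Radial approach is nontangential. -/
theorem tendsto_polar_stolz {r : ℕ → Ico (0 : ℝ) 1}
    (hr : Tendsto (fun n => (r n : ℝ)) atTop (𝓝 1)) (θ : ℝ) {a : ℝ} (ha : 1 < a) :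
    Tendsto (fun n => polar (r n) θ) atTop (stolz a (Circle.exp θ : ℂ)) := by
  refine tendsto_inf.2 ⟨tendsto_comap_iff.2 ?_, tendsto_principal.2 (Eventually.of_forall ?_)⟩
  · change Tendsto (fun n => (((r n : ℝ) : ℂ)) * (Circle.exp θ : ℂ)) atTop _
    have := ((Complex.continuous_ofReal.tendsto 1).comp hr).mul_const (Circle.exp θ : ℂ)
    simpa using this
  · intro n
    have h0 := (r n).2.1
    have h1 := (r n).2.2
    change ‖((r n : ℝ) : ℂ) * (Circle.exp θ : ℂ) - (Circle.exp θ : ℂ)‖ <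
      a * (1 - ‖((r n : ℝ) : ℂ) * (Circle.exp θ : ℂ)‖)
    rw [← sub_one_mul, norm_mul, norm_mul, Circle.norm_coe, mul_one, mul_one, Complex.norm_real,
      Real.norm_of_nonneg h0, ← Complex.ofReal_one, ← Complex.ofReal_sub, Complex.norm_real,
      Real.norm_of_nonpos (by linarith)]
    nlinarith

/-- Along radii tending to 1 the boundary function is an a.e. limit of continuous functions of `θ`.
-/
theorem IsBoundaryValue.aemeasurable {f : Hol} {b : ℝ → ℂ} (hb : IsBoundaryValue f b) :
    AEMeasurable b arc := by
  let r : ℕ → Ico (0 : ℝ) 1 := fun n => ⟨1 - 1 / ((n : ℝ) + 1), by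
    have : (1 : ℝ) / ((n : ℝ) + 1) ≤ 1 := by
      rw [div_le_one (by positivity)]
      linarith [n.cast_nonneg (α := ℝ)]
    linarith, by
    have : (0 : ℝ) < 1 / ((n : ℝ) + 1) := by positivity
    linarith⟩
  have hr : Tendsto (fun n => (r n : ℝ)) atTop (𝓝 1) := by
    simpa [r] using (tendsto_one_div_add_atTop_nhds_zero_nat (𝕜 := ℝ)).const_sub 1
  refine aemeasurable_of_tendsto_metrizable_ae' (f := fun n θ => f (polar (r n) θ))
    (fun n => ((continuous_hol f).comp (continuous_polar (r n))).aemeasurable) ?_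
  filter_upwards [hb] with θ h
  exact (h 2 one_lt_two).comp (tendsto_polar_stolz hr θ one_lt_two)

end BoundaryValue

/-! ### Orlicz estimates and multipliers -/

section Orlicz

theorem compLog_nonneg {φ : ℝ → ℝ} (h : ∀ t, 0 ≤ φ t) (s : ℝ) : 0 ≤ compLog φ s := by
  unfold compLog
  split_ifs
  exacts [le_rfl, h _]

theorem compLog_mono {φ : ℝ → ℝ} (h : ∀ t, 0 ≤ φ t) (hm : Monotone φ) {s t : ℝ} (hs : 0 ≤ s)
    (hst : s ≤ t) : compLog φ s ≤ compLog φ t := by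
  rcases hs.eq_or_lt with rfl | hs
  · simpa [compLog] using compLog_nonneg h t
  · simp only [compLog, hs.ne', (hs.trans_le hst).ne', if_false]
    exact hm (Real.log_le_log hs hst)

theorem measurable_compLog {φ : ℝ → ℝ} (hm : Monotone φ) : Measurable (compLog φ) :=
  Measurable.ite (measurableSet_singleton 0) measurable_const
    (hm.measurable.comp Real.measurable_log)

variable {φ γ : ℝ → ℝ}

theorem DeltaAdmissible.le_genInverse (hγ : DeltaAdmissible φ γ) {s u : ℝ} (hs : 0 < s)
    (hu : γ s < u) : s ≤ genInverse γ u := by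
  have hne : {t : ℝ | 0 < t ∧ u ≤ γ t}.Nonempty :=
    ((eventually_gt_atTop 0).and (hγ.tendsto.eventually_ge_atTop u)).exists
  exact le_csInf hne fun t ht =>
    ((hγ.strictMono.lt_iff_lt hs ht.1).1 (hu.trans_le ht.2)).le

/-- Concavity makes `γ` continuous at the infimum, which is positive. If `γ` were below `u` there,
it would stay below `u` slightly to the right, where the infimum forces points with `u ≤ γ t`. -/
theorem DeltaAdmissible.le_apply_genInverse (hγ : DeltaAdmissible φ γ) {u : ℝ}
    (hu : 0 < genInverse γ u) : u ≤ γ (genInverse γ u) := by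
  have hne : {t : ℝ | 0 < t ∧ u ≤ γ t}.Nonempty :=
    ((eventually_gt_atTop 0).and (hγ.tendsto.eventually_ge_atTop u)).exists
  by_contra! hlt
  have hc : ContinuousAt γ (genInverse γ u) :=
    (hγ.concave.continuousOn isOpen_Ioi).continuousAt (Ioi_mem_nhds hu)
  obtain ⟨x, hx, hxs⟩ := mem_nhdsGE_iff_exists_Ico_subset.1
    (mem_nhdsWithin_of_mem_nhds (hc.eventually_lt_const hlt))
  obtain ⟨t, ht, htx⟩ := exists_lt_of_csInf_lt hne hx
  exact ht.2.not_gt (hxs ⟨csInf_le ⟨0, fun y hy => hy.1.le⟩ ht, htx⟩)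

/-- The pointwise estimate behind the multiplier property. -/
theorem DeltaAdmissible.exists_add_le (hφ : StronglyConvex φ) (hγ : DeltaAdmissible φ γ) :
    ∃ c K : ℝ, 0 ≤ c ∧ 0 ≤ K ∧
      ∀ s u, φ (s + u) ≤ c * (φ s + φ (genInverse γ u) + K) := by
  obtain ⟨c, hc, t₀, h⟩ := hγ.bound
  set T := max t₀ 1 with hT
  have hT0 : 0 < T := zero_lt_one.trans_le (le_max_right _ _)
  have hc0 : 0 ≤ c := by linarith
  refine ⟨c, φ T, hc0, hφ.nonneg T, fun s u => ?_⟩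
  -- Admissibility needs a positive argument beyond `t₀`; raising `s` to `m` costs only the constant
  -- `φ T`.
  set m := max s T
  have hm0 : 0 < m := hT0.trans_le (le_max_right _ _)
  have hmt : t₀ ≤ m := (le_max_left _ _).trans (le_max_right _ _)
  have hφm : φ m ≤ φ s + φ T := by
    rw [hφ.mono.map_max]
    exact max_le_add_of_nonneg (hφ.nonneg s) (hφ.nonneg T)
  have hsm : φ (s + u) ≤ φ (m + u) := hφ.mono (by gcongr; exact le_max_left _ _)
  rcases le_or_gt u (γ m) with hu | hu
  · calc φ (s + u) ≤ φ (m + γ m) := hsm.trans (hφ.mono (by gcongr))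
      _ ≤ c * φ m := h m hm0 hmt
      _ ≤ _ := by
        gcongr
        linarith [hφ.nonneg (genInverse γ u)]
  · have hmg := hγ.le_genInverse hm0 hu
    have hg0 := hm0.trans_le hmg
    calc φ (s + u) ≤ φ (genInverse γ u + γ (genInverse γ u)) :=
          hsm.trans (hφ.mono (add_le_add hmg (hγ.le_apply_genInverse hg0)))
      _ ≤ c * φ (genInverse γ u) := h _ hg0 (hmt.trans hmg)
      _ ≤ _ := by
        gcongr
        linarith [hφ.nonneg s, hφ.nonneg T]

theorem DeltaAdmissible.exists_compLog_mul_le (hφ : StronglyConvex φ)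
    (hγ : DeltaAdmissible φ γ) :
    ∃ c K : ℝ, 0 ≤ c ∧ 0 ≤ K ∧ ∀ x y,
      compLog φ (x * y) ≤ c * (compLog φ x + compLog (φ ∘ genInverse γ) y + K) := by
  obtain ⟨c, K, hc, hK, h⟩ := hγ.exists_add_le hφ
  refine ⟨c, K, hc, hK, fun x y => ?_⟩
  by_cases hxy : x * y = 0
  -- A vanishing factor makes the left side zero, by the convention `φ (-∞) = 0`.
  · rw [compLog, if_pos hxy]
    exact mul_nonneg hc (add_nonneg (add_nonneg (compLog_nonneg hφ.nonneg x)
      (compLog_nonneg (fun t => hφ.nonneg _) y)) hK)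
  · obtain ⟨hx, hy⟩ := mul_ne_zero_iff.1 hxy
    simp only [compLog, hxy, hx, hy, if_false, Real.log_mul hx hy]
    exact h _ _

/-- Finiteness of an Orlicz integral from a pointwise bound by two others. -/
theorem lintegral_ofReal_lt_top_of_le {α : Type*} [MeasurableSpace α] {μ : Measure α}
    [IsFiniteMeasure μ] {F G H : α → ℝ} {c K : ℝ} (hc : 0 ≤ c)
    (hG : AEMeasurable G μ) (hle : ∀ x, F x ≤ c * (G x + H x + K))
    (hGi : ∫⁻ x, ENNReal.ofReal (G x) ∂μ < ⊤) (hHi : ∫⁻ x, ENNReal.ofReal (H x) ∂μ < ⊤) :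
    ∫⁻ x, ENNReal.ofReal (F x) ∂μ < ⊤ := by
  calc ∫⁻ x, ENNReal.ofReal (F x) ∂μ
      ≤ ∫⁻ x, ENNReal.ofReal c *
          (ENNReal.ofReal (G x) + ENNReal.ofReal (H x) + ENNReal.ofReal K) ∂μ := by
        refine lintegral_mono fun x => ?_
        refine (ENNReal.ofReal_le_ofReal (hle x)).trans ?_
        rw [ENNReal.ofReal_mul hc]
        gcongr
        exact ENNReal.ofReal_add_le.trans (by gcongr; exact ENNReal.ofReal_add_le)
    _ = ENNReal.ofReal c * (∫⁻ x, ENNReal.ofReal (G x) ∂μ + ∫⁻ x, ENNReal.ofReal (H x) ∂μ +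
          ENNReal.ofReal K * μ univ) := by
        rw [lintegral_const_mul' _ _ ENNReal.ofReal_ne_top,
          -- Additivity needs only one measurable summand, so `H` may be arbitrary.
          lintegral_add_right _ measurable_const, lintegral_add_left' hG.ennreal_ofReal,
          lintegral_const]
    _ < ⊤ := ENNReal.mul_lt_top ENNReal.ofReal_lt_top
        (ENNReal.add_lt_top.2 ⟨ENNReal.add_lt_top.2 ⟨hGi, hHi⟩,
          ENNReal.mul_lt_top ENNReal.ofReal_lt_top (measure_lt_top _ _)⟩)

theorem algebraMap_mem_hardyOrliczClass (ψ : ℝ → ℝ) (c : ℂ) :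
    algebraMap ℂ Hol c ∈ HardyOrliczClass ψ :=
  ⟨Smirnov.algebraMap_mem c, fun _ => c, isBoundaryValue_algebraMap c, by
    rw [lintegral_const]
    exact ENNReal.mul_lt_top ENNReal.ofReal_lt_top (measure_lt_top _ _)⟩

theorem IsBoundaryValue.aemeasurable_compLog (hφ : StronglyConvex φ) {f : Hol} {b : ℝ → ℂ}
    (hb : IsBoundaryValue f b) : AEMeasurable (fun θ => compLog φ ‖b θ‖) arc :=
  (measurable_compLog hφ.mono).comp_aemeasurable hb.aemeasurable.norm

theorem DeltaAdmissible.hardyOrliczClass_subset_mult (hφ : StronglyConvex φ)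
    (hγ : DeltaAdmissible φ γ) :
    HardyOrliczClass (φ ∘ genInverse γ) ⊆ Mult (HardyOrliczClass φ) := by
  obtain ⟨c, K, hc, -, h⟩ := hγ.exists_compLog_mul_le hφ
  rintro g ⟨hg, b, hb, hbi⟩ f ⟨hf, a, ha, hai⟩
  -- The estimate is asymmetric: `f` must be the first factor, the multiplier `g` the second.
  rw [mul_comm]
  refine ⟨Smirnov.mul hf hg, _, ha.mul hb, ?_⟩
  refine lintegral_ofReal_lt_top_of_le (K := K) hc (ha.aemeasurable_compLog hφ) (fun θ => ?_) hai hbi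
  rw [norm_mul]
  exact h _ _

theorem DeltaAdmissible.hardyOrliczClass_add (hφ : StronglyConvex φ) (hγ : DeltaAdmissible φ γ)
    {f g : Hol} (hf : f ∈ HardyOrliczClass φ) (hg : g ∈ HardyOrliczClass φ) :
    f + g ∈ HardyOrliczClass φ := by
  obtain ⟨c, K, hc, -, h⟩ := hγ.exists_compLog_mul_le hφ
  obtain ⟨hf, a, ha, hai⟩ := hf
  obtain ⟨hg, b, hb, hbi⟩ := hg
  refine ⟨Smirnov.add hf hg, _, ha.add hb, ?_⟩
  refine lintegral_ofReal_lt_top_of_le (K := compLog (φ ∘ genInverse γ) 2 + K) hc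
    (ha.aemeasurable_compLog hφ) (fun θ => ?_) hai hbi
  have hmax : compLog φ (max ‖a θ‖ ‖b θ‖) ≤ compLog φ ‖a θ‖ + compLog φ ‖b θ‖ := by
    rcases max_choice ‖a θ‖ ‖b θ‖ with e | e <;> rw [e]
    · linarith [compLog_nonneg hφ.nonneg ‖b θ‖]
    · linarith [compLog_nonneg hφ.nonneg ‖a θ‖]
  -- The constant 2 plays the multiplier; its contribution is absorbed into the constant term.
  calc compLog φ ‖a θ + b θ‖ ≤ compLog φ (max ‖a θ‖ ‖b θ‖ * 2) :=
        compLog_mono hφ.nonneg hφ.mono (norm_nonneg _) (by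
          linarith [norm_add_le (a θ) (b θ), le_max_left ‖a θ‖ ‖b θ‖,
            le_max_right ‖a θ‖ ‖b θ‖])
    _ ≤ c * (compLog φ (max ‖a θ‖ ‖b θ‖) + compLog (φ ∘ genInverse γ) 2 + K) := h _ _
    _ ≤ _ := by
        rw [← add_assoc]
        gcongr

end Orlicz

end HardyOrlicz

theorem theorem1 (φ γ : ℝ → ℝ) (hφ : HardyOrlicz.StronglyConvex φ)
    (hΔ : HardyOrlicz.DeltaCondition φ) (hγ : HardyOrlicz.DeltaAdmissible φ γ) :
    (Algebra.adjoin ℂ (HardyOrlicz.HardyOrliczClass (φ ∘ HardyOrlicz.genInverse γ)) :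
        Set HardyOrlicz.Hol) ⊆
      HardyOrlicz.Mult (HardyOrlicz.HardyOrliczClass φ) := by
  intro g hg
  induction hg using Algebra.adjoin_induction with
  | mem g hg => exact hγ.hardyOrliczClass_subset_mult hφ hg
  | algebraMap c =>
    exact hγ.hardyOrliczClass_subset_mult hφ (HardyOrlicz.algebraMap_mem_hardyOrliczClass _ c)
  | add g₁ g₂ _ _ h₁ h₂ =>
    intro f hf
    rw [add_mul]
    exact hγ.hardyOrliczClass_add hφ (h₁ f hf) (h₂ f hf)
  | mul g₁ g₂ _ _ h₁ h₂ =>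
    intro f hf
    rw [mul_assoc]
    exact h₁ _ (h₂ f hf)
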